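/- Let $\alpha>0$, $\lambda>1/\alpha$, $\beta>0$, $\overline{\gamma}>0$ and $\varphi>0$. Let $\tau$ be a Gamma random variable with density $\frac{\beta^{\lambda}}{\Gamma(\lambda)}t^{\lambda-1}e^{-\beta t}$, $t>0$, and let $X,Y$ be real random variables which, conditionally on $\tau$, are independent and Gaussian with mean $0$ and variance $\frac{1}{2\tau}$. Let $H=(X^{2}+Y^{2})^{1/\alpha}$ (the $\alpha$-Lomax fading variable), let $\Gamma=\overline{\gamma}\,H/\mathbb{E}[H]$ be the instantaneous signal-to-noise ratio, $\mathcal{M}_{\Gamma}(s)=\mathbb{E}[e^{-s\Gamma}]$, and $$\zeta=\left(\frac{\Gamma(1+\frac1\alpha)\,\Gamma(\lambda-\frac1\alpha)}{\Gamma(\lambda)}\right)^{\alpha}.$$ For parameters $a_j,b_j\in\mathbb{C}$ and $A_j,B_j\ge 0$, the Fox H-function is $${\sf H}^{m,n}_{p,q}\!\left[z\left|\begin{matrix}(a_1,A_1),\dots,(a_p,A_p)\\(b_1,B_1),\dots,(b_q,B_q)\end{matrix}\right.\right]=\frac{1}{2\pi i}\int_{c-i\infty}^{c+i\infty}\frac{\prod_{j=1}^{m}\Gamma(b_j+B_js)\prod_{j=1}^{n}\Gamma(1-a_j-A_js)}{\prod_{j=n+1}^{p}\Gamma(a_j+A_js)\prod_{j=m+1}^{q}\Gamma(1-b_j-B_js)}\,z^{-s}\,ds,$$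 where the line $\operatorname{Re}s=c$ has the poles of the factors $\Gamma(b_j+B_js)$, $j\le m$, on its left and those of the factors $\Gamma(1-a_j-A_js)$, $j\le n$, on its right (a factor with $A_j=0$ is a constant). Then the integral that defines the average bit error rate of a coherent binary modulation with parameter $\varphi$, $$\overline{P_b}=\frac1\pi\int_0^{\pi/2}\mathcal{M}_{\Gamma}\!\left(\frac{\varphi}{\sin^{2}\theta}\right)d\theta,$$ converges; for the parameters below such a line exists, and along each such line the integral that defines ${\sf H}^{1,4}_{4,2}$ converges absolutely with one and the same value; and $$\overline{P_b}=\frac{\alpha}{2\pi\,\Gamma(\lambda)}\,{\sf H}^{1,4}_{4,2}\!\left[\frac{\zeta}{\overline{\gamma}^{\alpha}\varphi^{\alpha}}\left|\begin{matrix}(\frac12,\alpha),(\frac12,0),(1-\lambda,1),(1,\alpha)\\(1,1),(0,\alpha)\end{matrix}\right.\right].$$ -/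

import Mathlib

open MeasureTheory ProbabilityTheory

noncomputable section

namespace FoxH

/-- The Mellin–Barnes integrand of the Fox H-function `H^{m,n}_{p,q}[z | (a_j, A_j); (b_j, B_j)]`:
the product of `Γ(b_j + B_j s)` over the first `m` lower pairs and of `Γ(1 - a_j - A_j s)` over the
first `n` upper pairs, divided by the product of `Γ(1 - b_j - B_j s)` over the other lower pairs and
of `Γ(a_j + A_j s)` over the other upper pairs, times `z ^ (-s)`. -/
def integrand (m n : ℕ) {p q : ℕ} (a : Fin p → ℂ × ℝ) (b : Fin q → ℂ × ℝ) (z s : ℂ) : ℂ :=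
  (∏ j : Fin q, if (j : ℕ) < m then Complex.Gamma ((b j).1 + (b j).2 * s)
      else (Complex.Gamma (1 - (b j).1 - (b j).2 * s))⁻¹) *
  (∏ j : Fin p, if (j : ℕ) < n then Complex.Gamma (1 - (a j).1 - (a j).2 * s)
      else (Complex.Gamma ((a j).1 + (a j).2 * s))⁻¹) *
  z ^ (-s)

/-- The line `Re s = c` separates the poles of `Γ(b_j + B_j s)`, `j ≤ m` (on its left), from the
poles of `Γ(1 - a_j - A_j s)`, `j ≤ n` (on its right). -/
def Separates (m n : ℕ) {p q : ℕ} (a : Fin p → ℂ × ℝ) (b : Fin q → ℂ × ℝ) (c : ℝ) : Prop :=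
  (∀ j : Fin q, (j : ℕ) < m → ∀ (s : ℂ) (k : ℕ), (b j).1 + (b j).2 * s = -(k : ℂ) → s.re < c) ∧
  (∀ j : Fin p, (j : ℕ) < n → ∀ (s : ℂ) (k : ℕ), 1 - (a j).1 - (a j).2 * s = -(k : ℂ) → c < s.re)

/-- The contour integral `(1 / 2πi) ∫ integrand ds` along the line from `c - i∞` to `c + i∞`,
parametrized by `s = c + i t`. -/
def lineIntegral (m n : ℕ) {p q : ℕ} (a : Fin p → ℂ × ℝ) (b : Fin q → ℂ × ℝ) (z : ℂ) (c : ℝ) : ℂ :=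
  (2 * Real.pi * Complex.I)⁻¹ *
    ∫ t : ℝ, integrand m n a b z (c + t * Complex.I) * Complex.I

end FoxH

open Classical in
/-- The Fox H-function `H^{m,n}_{p,q}[z | (a_j, A_j); (b_j, B_j)]`, for parameters whose two families
of poles can be separated by a vertical line: its Mellin–Barnes integral along such a line. -/
def foxH (m n : ℕ) {p q : ℕ} (a : Fin p → ℂ × ℝ) (b : Fin q → ℂ × ℝ) (z : ℂ) : ℂ :=
  if h : ∃ c : ℝ, FoxH.Separates m n a b c then FoxH.lineIntegral m n a b z h.choose else 0

namespace AlphaLomax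

/-- The centred Gaussian law of variance `1 / (2 t)`, as a kernel in `t`. (For `t ≤ 0`, which has
probability zero below, the value is a Dirac mass.) -/
def gaussianKernel : Kernel ℝ ℝ where
  toFun t := gaussianReal 0 (1 / (2 * t)).toNNReal
  measurable' := by
    have h : Measurable (fun t : ℝ => ((0 : ℝ), (1 / (2 * t)).toNNReal)) := by fun_prop
    exact measurable_gaussianReal.comp h

instance : IsMarkovKernel gaussianKernel :=
  ⟨fun t => inferInstanceAs (IsProbabilityMeasure (gaussianReal 0 (1 / (2 * t)).toNNReal))⟩

/-- The physical model of Lomax fading: `τ` is Gamma distributed with density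
`β ^ lam / Γ(lam) * t ^ (lam - 1) * exp (-β t)` on `t > 0` and, given `τ`, the in-phase and quadrature
components `X` and `Y` are independent, Gaussian, of mean `0` and variance `1 / (2 τ)`. -/
structure IsLomaxModel {Ω : Type*} [MeasurableSpace Ω] (P : Measure Ω) (lam β : ℝ)
    (τ X Y : Ω → ℝ) : Prop where
  aemeasurable_tau : AEMeasurable τ P
  aemeasurable_X : AEMeasurable X P
  aemeasurable_Y : AEMeasurable Y P
  law : P.map (fun ω => (τ ω, X ω, Y ω)) = gammaMeasure lam β ⊗ₘ (gaussianKernel ×ₖ gaussianKernel)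

/-- The α-Lomax fading variable `H = (X² + Y²) ^ (1/α)`. -/
def fading {Ω : Type*} (α : ℝ) (X Y : Ω → ℝ) (ω : Ω) : ℝ :=
  (X ω ^ 2 + Y ω ^ 2) ^ (1 / α)

/-- The signal power `Z = H / E[H]`. -/
def power {Ω : Type*} [MeasurableSpace Ω] (P : Measure Ω) (α : ℝ) (X Y : Ω → ℝ) (ω : Ω) : ℝ :=
  fading α X Y ω / ∫ ω', fading α X Y ω' ∂P

/-- The instantaneous signal-to-noise ratio `Γ = γbar * Z`. -/
def snr {Ω : Type*} [MeasurableSpace Ω] (P : Measure Ω) (α γbar : ℝ) (X Y : Ω → ℝ) (ω : Ω) : ℝ :=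
  γbar * power P α X Y ω

/-- The moment generating function in the sign convention of communication theory,
`M_G(s) = E[exp (-s G)]`. -/
def laplaceMGF {Ω : Type*} [MeasurableSpace Ω] (P : Measure Ω) (G : Ω → ℝ) (s : ℝ) : ℝ :=
  mgf G P (-s)

/-- The average bit error rate of a coherent binary modulation with parameter `φ`, for the
instantaneous signal-to-noise ratio `G`. -/
def averageBER {Ω : Type*} [MeasurableSpace Ω] (P : Measure Ω) (G : Ω → ℝ) (φ : ℝ) : ℝ :=
  1 / Real.pi * ∫ θ in (0 : ℝ)..(Real.pi / 2), laplaceMGF P G (φ / Real.sin θ ^ 2)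

/-- The constant `ζ = (Γ(1 + 1/α) Γ(lam - 1/α) / Γ(lam)) ^ α`. -/
def zeta (α lam : ℝ) : ℝ :=
  (Real.Gamma (1 + 1 / α) * Real.Gamma (lam - 1 / α) / Real.Gamma lam) ^ α

/-- The upper parameters `(1/2, α), (1/2, 0), (1 - lam, 1), (1, α)`. -/
def upper (α lam : ℝ) : Fin 4 → ℂ × ℝ :=
  ![(1 / 2, α), (1 / 2, 0), (1 - (lam : ℂ), 1), (1, α)]

/-- The lower parameters `(1, 1), (0, α)`. -/
def lower (α : ℝ) : Fin 2 → ℂ × ℝ :=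
  ![(1, 1), (0, α)]

end AlphaLomax

end

/-!
The function `exp (-x)` is the Cahen–Mellin integral of `Γ(w) x ^ (-w)` along `Re w = u > 0`. With
`x = φ G / sin² θ` in the bit error rate of a signal-to-noise ratio `G`, Fubini's theorem separates
the variables and leaves the Mellin–Barnes integral of `Γ(w)` times the sine moment
`∫ sin^{2w} θ dθ`, a ratio of Gamma values, times `φ ^ (-w)` and the moment `E[G ^ (-w)]`; the same
application of Fubini gives its absolute convergence. For Lomax fading, `X² + Y²` is a Gamma mixture
of exponential laws, whose complex moments are again products of Gamma values, so that the
substitution `w = -α s` turns the integrand into that of the Fox H-function. The bit error rate does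
not depend on `u`, whence every separating line gives the same value.
-/

section GammaVerticalLine

open Complex Set

theorem norm_Gamma_le_Gamma_re {z : ℂ} (hz : 0 < z.re) : ‖Gamma z‖ ≤ Real.Gamma z.re := by
  rw [Gamma_eq_integral hz, GammaIntegral, Real.Gamma_eq_integral hz]
  refine (norm_integral_le_integral_norm _).trans_eq
    (setIntegral_congr_fun measurableSet_Ioi fun x hx => ?_)
  simp only [norm_mul, norm_cpow_eq_rpow_re_of_pos hx, norm_real, Real.norm_eq_abs,
    abs_of_pos (Real.exp_pos _), sub_re, one_re]

theorem sq_norm_mul_norm_Gamma_le {z : ℂ} (hz : 0 < z.re) :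
    ‖z‖ ^ 2 * ‖Gamma z‖ ≤ Real.Gamma (z.re + 2) := by
  have hz0 : z ≠ 0 := ne_zero_of_re_pos hz
  have hz1 : z + 1 ≠ 0 := ne_zero_of_re_pos (by rw [add_re, one_re]; positivity)
  have hnorm : ‖z‖ ≤ ‖z + 1‖ := by
    rw [← sq_le_sq₀ (norm_nonneg _) (norm_nonneg _), Complex.sq_norm, Complex.sq_norm, normSq_apply,
      normSq_apply, add_re, add_im, one_re, one_im]
    nlinarith
  calc ‖z‖ ^ 2 * ‖Gamma z‖ = ‖z‖ * (‖z‖ * ‖Gamma z‖) := by ring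
    _ ≤ ‖z + 1‖ * (‖z‖ * ‖Gamma z‖) := by gcongr
    _ = ‖Gamma (z + 2)‖ := by
        rw [← norm_mul, ← norm_mul, ← Gamma_add_one z hz0, ← Gamma_add_one (z + 1) hz1, add_assoc,
          one_add_one_eq_two]
    _ ≤ Real.Gamma (z.re + 2) := norm_Gamma_le_Gamma_re (by rw [add_re, re_ofNat]; positivity)

theorem continuous_Gamma_verticalLine {u : ℝ} (hu : 0 < u) :
    Continuous fun t : ℝ => Gamma (u + t * I) := by
  refine continuous_iff_continuousAt.2 fun t => ContinuousAt.comp' ?_ (by fun_prop)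
  refine (differentiableAt_Gamma _ fun m hm => ?_).continuousAt
  have hre : u = -m := by simpa using congrArg re hm
  linarith [(m.cast_nonneg : (0 : ℝ) ≤ m)]

theorem verticalIntegrable_Gamma {u : ℝ} (hu : 0 < u) : VerticalIntegrable Gamma u := by
  set m : ℝ := min (u ^ 2) 1
  have hm : 0 < m := by positivity
  refine Integrable.mono' (integrable_inv_one_add_sq.const_mul (Real.Gamma (u + 2) / m))
    (continuous_Gamma_verticalLine hu).aestronglyMeasurable (.of_forall fun t => ?_)
  set z : ℂ := u + t * I
  have hre : z.re = u := by simp [z]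
  have hlower : m * (1 + t ^ 2) ≤ ‖z‖ ^ 2 := by
    rw [Complex.sq_norm, normSq_add_mul_I]
    nlinarith [min_le_left (u ^ 2) 1, min_le_right (u ^ 2) 1, sq_nonneg t]
  have hupper : ‖z‖ ^ 2 * ‖Gamma z‖ ≤ Real.Gamma (u + 2) := by
    simpa only [hre] using sq_norm_mul_norm_Gamma_le (z := z) (by rwa [hre])
  have hbound : m * (1 + t ^ 2) * ‖Gamma z‖ ≤ Real.Gamma (u + 2) :=
    (mul_le_mul_of_nonneg_right hlower (norm_nonneg _)).trans hupper
  rw [div_mul_eq_mul_div, le_div_iff₀ hm, ← div_eq_mul_inv, le_div_iff₀ (by positivity)]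
  linarith

theorem mellin_exp_neg {s : ℂ} (hs : 0 < s.re) :
    mellin (fun x : ℝ => (Real.exp (-x) : ℂ)) s = Gamma s := by
  rw [← GammaIntegral_eq_mellin, Gamma_eq_integral hs]

theorem exp_neg_eq_integral_Gamma {u x : ℝ} (hu : 0 < u) (hx : 0 < x) :
    (Real.exp (-x) : ℂ) = (2 * Real.pi : ℂ)⁻¹ *
      ∫ t : ℝ, Gamma (u + t * I) * (x : ℂ) ^ (-(u + t * I)) := by
  have hmellin (t : ℝ) : mellin (fun x : ℝ => (Real.exp (-x) : ℂ)) (u + t * I) =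
      Gamma (u + t * I) := mellin_exp_neg (by simpa using hu)
  have hconv : MellinConvergent (fun x : ℝ => (Real.exp (-x) : ℂ)) u :=
    (GammaIntegral_convergent (s := u) (by simpa using hu)).congr_fun
      (fun _ _ => mul_comm _ _) measurableSet_Ioi
  have hvert : VerticalIntegrable (mellin fun x : ℝ => (Real.exp (-x) : ℂ)) u := by
    simpa only [VerticalIntegrable, hmellin] using verticalIntegrable_Gamma hu
  rw [← mellinInv_mellin_eq u _ hx hconv hvert (by fun_prop), mellinInv, real_smul]
  simp only [hmellin, smul_eq_mul, one_div, ofReal_inv, ofReal_mul, ofReal_ofNat,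
    mul_comm (Gamma _)]

end GammaVerticalLine

section VerticalLineScaling

open Complex

variable {E : Type*} [NormedAddCommGroup E] {f : ℂ → E} {a c : ℝ}

theorem verticalIntegrable_comp_mul_left (ha : a ≠ 0)
    (hf : VerticalIntegrable f (a * c)) : VerticalIntegrable (fun s => f (a * s)) c := by
  refine (Integrable.comp_mul_left' hf ha).congr (.of_forall fun t => ?_)
  simp only [ofReal_mul, mul_add, mul_assoc]

theorem integral_verticalLine_comp_mul_left [NormedSpace ℝ E] (f : ℂ → E) (a c : ℝ) :
    ∫ t : ℝ, f (a * (c + t * I)) = |a⁻¹| • ∫ t : ℝ, f ((a * c : ℝ) + t * I) := by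
  rw [← Measure.integral_comp_mul_left (fun t : ℝ => f ((a * c : ℝ) + t * I)) a]
  simp only [ofReal_mul, mul_add, mul_assoc]

end VerticalLineScaling

section LaplaceFunctional

open Complex

variable {E : Type*} [MeasurableSpace E] {μ : Measure E} {f : E → ℝ}

theorem integrable_ofReal_cpow_iff (hf : AEMeasurable f μ) (hpos : ∀ᵐ x ∂μ, 0 < f x) (s : ℂ) :
    Integrable (fun x => (f x : ℂ) ^ s) μ ↔ Integrable (fun x => f x ^ s.re) μ := by
  have hmeas : AEStronglyMeasurable (fun x => (f x : ℂ) ^ s) μ :=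
    ((measurable_ofReal.comp_aemeasurable hf).pow_const s).aestronglyMeasurable
  rw [← integrable_norm_iff hmeas]
  exact integrable_congr (hpos.mono fun x hx => norm_cpow_eq_rpow_re_of_pos hx s)

variable {u : ℝ}

theorem integrable_prod_Gamma_mul_cpow (hu : 0 < u) (hf : AEMeasurable f μ)
    (hpos : ∀ᵐ x ∂μ, 0 < f x) (hint : Integrable (fun x => f x ^ (-u)) μ) :
    Integrable (fun p : E × ℝ => Gamma (u + p.2 * I) * (f p.1 : ℂ) ^ (-(u + p.2 * I)))
      (μ.prod volume) := by
  have hΓ := verticalIntegrable_Gamma hu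
  refine (hint.mul_prod hΓ.norm).mono' ?_ ?_
  · have hbase : AEMeasurable (fun p : E × ℝ => (f p.1 : ℂ)) (μ.prod volume) :=
      measurable_ofReal.comp_aemeasurable hf.comp_fst
    exact hΓ.aestronglyMeasurable.comp_snd.mul (hbase.pow (by fun_prop)).aestronglyMeasurable
  · filter_upwards [Measure.quasiMeasurePreserving_fst.ae hpos] with p hp
    rw [norm_mul, norm_cpow_eq_rpow_re_of_pos hp, neg_re, mul_comm, add_re, ofReal_re,
      re_ofReal_mul, I_re, mul_zero, add_zero]

variable [SFinite μ]

theorem verticalIntegrable_Gamma_mul_integral_cpow (hu : 0 < u) (hf : AEMeasurable f μ)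
    (hpos : ∀ᵐ x ∂μ, 0 < f x) (hint : Integrable (fun x => f x ^ (-u)) μ) :
    VerticalIntegrable (fun s => Gamma s * ∫ x, (f x : ℂ) ^ (-s) ∂μ) u := by
  simpa only [VerticalIntegrable, integral_const_mul] using
    (integrable_prod_Gamma_mul_cpow hu hf hpos hint).integral_prod_right

theorem integral_exp_neg_eq_integral_Gamma_mul (hu : 0 < u) (hf : AEMeasurable f μ)
    (hpos : ∀ᵐ x ∂μ, 0 < f x) (hint : Integrable (fun x => f x ^ (-u)) μ) :
    ((∫ x, Real.exp (-f x) ∂μ : ℝ) : ℂ) = (2 * Real.pi : ℂ)⁻¹ *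
      ∫ t : ℝ, Gamma (u + t * I) * ∫ x, (f x : ℂ) ^ (-(u + t * I)) ∂μ :=
  calc ((∫ x, Real.exp (-f x) ∂μ : ℝ) : ℂ) = ∫ x, (Real.exp (-f x) : ℂ) ∂μ :=
        integral_ofReal.symm
    _ = ∫ x, (2 * Real.pi : ℂ)⁻¹ *
          (∫ t : ℝ, Gamma (u + t * I) * (f x : ℂ) ^ (-(u + t * I))) ∂μ :=
        integral_congr_ae (hpos.mono fun x hx => exp_neg_eq_integral_Gamma hu hx)
    _ = _ := by
        rw [integral_const_mul,
          integral_integral_swap (integrable_prod_Gamma_mul_cpow hu hf hpos hint)]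
        simp only [integral_const_mul]

end LaplaceFunctional

section SineMoments

open Complex Set

theorem sin_pos_of_mem_Ioo_zero_pi_div_two {θ : ℝ} (hθ : θ ∈ Ioo 0 (Real.pi / 2)) :
    0 < Real.sin θ :=
  Real.sin_pos_of_pos_of_lt_pi hθ.1 (by linarith [hθ.1, hθ.2])

theorem cos_pos_of_mem_Ioo_zero_pi_div_two {θ : ℝ} (hθ : θ ∈ Ioo 0 (Real.pi / 2)) :
    0 < Real.cos θ :=
  Real.cos_pos_of_mem_Ioo ⟨by linarith [hθ.1, Real.pi_pos], hθ.2⟩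

theorem injOn_sin_sq : InjOn (fun θ : ℝ => Real.sin θ ^ 2) (Ioo 0 (Real.pi / 2)) := by
  intro x hx y hy hxy
  have hmem {θ : ℝ} (hθ : θ ∈ Ioo 0 (Real.pi / 2)) : θ ∈ Icc (-(Real.pi / 2)) (Real.pi / 2) :=
    ⟨by linarith [hθ.1, hθ.2], hθ.2.le⟩
  exact Real.injOn_sin (hmem hx) (hmem hy)
    ((pow_left_inj₀ (sin_pos_of_mem_Ioo_zero_pi_div_two hx).le
      (sin_pos_of_mem_Ioo_zero_pi_div_two hy).le two_ne_zero).1 hxy)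

theorem image_sin_sq_Ioo : (fun θ : ℝ => Real.sin θ ^ 2) '' Ioo 0 (Real.pi / 2) = Ioo 0 1 := by
  refine Subset.antisymm (image_subset_iff.2 fun θ hθ => ?_) fun y hy => ?_
  · have hsin := sin_pos_of_mem_Ioo_zero_pi_div_two hθ
    have hcos := cos_pos_of_mem_Ioo_zero_pi_div_two hθ
    exact ⟨by positivity, by nlinarith [Real.sin_sq_add_cos_sq θ]⟩
  · have hsqrt : Real.sqrt y < 1 := by
      rw [Real.sqrt_lt' one_pos, one_pow]
      exact hy.2
    refine ⟨Real.arcsin (Real.sqrt y), ⟨Real.arcsin_pos.2 (Real.sqrt_pos.2 hy.1),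
      Real.arcsin_lt_pi_div_two.2 hsqrt⟩, ?_⟩
    simp only [Real.sin_arcsin (by linarith [Real.sqrt_nonneg y]) hsqrt.le, Real.sq_sqrt hy.1.le]

theorem ofReal_sq_cpow_sub_one_mul_self {x : ℝ} (hx : 0 < x) (u : ℂ) :
    ((x ^ 2 : ℝ) : ℂ) ^ (u - 1) * x = (x : ℂ) ^ (2 * u - 1) := by
  have hx0 : (x : ℂ) ≠ 0 := ofReal_ne_zero.2 hx.ne'
  rw [← Real.rpow_two, ← cpow_mul_ofReal_nonneg hx.le, ofReal_ofNat]
  nth_rw 2 [← cpow_one (x : ℂ)]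
  rw [← cpow_add _ _ hx0]
  ring_nf

theorem betaIntegral_eq_integral_sin_cpow_mul_cos_cpow (u v : ℂ) :
    betaIntegral u v = 2 * ∫ θ in Ioo 0 (Real.pi / 2),
      (Real.sin θ : ℂ) ^ (2 * u - 1) * (Real.cos θ : ℂ) ^ (2 * v - 1) := by
  rw [betaIntegral, intervalIntegral.integral_of_le zero_le_one, integral_Ioc_eq_integral_Ioo,
    ← image_sin_sq_Ioo, integral_image_eq_integral_abs_deriv_smul measurableSet_Ioo
      (f' := fun θ => 2 * Real.sin θ * Real.cos θ) (fun θ _ => by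
        simpa using ((Real.hasDerivAt_sin θ).fun_pow 2).hasDerivWithinAt) injOn_sin_sq,
    ← integral_const_mul]
  refine setIntegral_congr_fun measurableSet_Ioo fun θ hθ => ?_
  have hsin := sin_pos_of_mem_Ioo_zero_pi_div_two hθ
  have hcos := cos_pos_of_mem_Ioo_zero_pi_div_two hθ
  have hcompl : (1 : ℂ) - ((Real.sin θ ^ 2 : ℝ) : ℂ) = ((Real.cos θ ^ 2 : ℝ) : ℂ) := by
    rw [Real.cos_sq', ofReal_sub, ofReal_one]
  rw [hcompl, abs_of_pos (by positivity), real_smul, ← ofReal_sq_cpow_sub_one_mul_self hsin,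
    ← ofReal_sq_cpow_sub_one_mul_self hcos]
  push_cast
  ring

theorem integral_sin_cpow {s : ℂ} (hs : -1 < s.re) :
    ∫ θ in Ioo 0 (Real.pi / 2), (Real.sin θ : ℂ) ^ s =
      Real.sqrt Real.pi / 2 * (Gamma ((s + 1) / 2) / Gamma (s / 2 + 1)) := by
  have hre : 0 < ((s + 1) / 2).re := by
    simp only [div_ofNat_re, add_re, one_re]
    linarith
  have hsqrt : (Real.pi : ℂ) ^ (1 / 2 : ℂ) = Real.sqrt Real.pi := by
    rw [Real.sqrt_eq_rpow, ofReal_cpow Real.pi_pos.le]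
    norm_num
  have hbeta := betaIntegral_eq_integral_sin_cpow_mul_cos_cpow ((s + 1) / 2) (1 / 2)
  rw [betaIntegral_eq_Gamma_mul_div _ _ hre (by norm_num), Gamma_one_half_eq, hsqrt,
    show (s + 1) / 2 + 1 / 2 = s / 2 + 1 by ring, show 2 * ((s + 1) / 2) - 1 = s by ring,
    show (2 : ℂ) * (1 / 2) - 1 = 0 by norm_num] at hbeta
  simp only [cpow_zero, mul_one] at hbeta
  linear_combination -hbeta / 2

theorem integrable_sin_cpow {s : ℂ} (hs : -1 < s.re) :
    IntegrableOn (fun θ : ℝ => (Real.sin θ : ℂ) ^ s) (Ioo 0 (Real.pi / 2)) := by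
  refine Integrable.of_integral_ne_zero ?_
  rw [integral_sin_cpow hs]
  have hnum : Gamma ((s + 1) / 2) ≠ 0 := Gamma_ne_zero_of_re_pos (by
    simp only [div_ofNat_re, add_re, one_re]
    linarith)
  have hden : Gamma (s / 2 + 1) ≠ 0 := Gamma_ne_zero_of_re_pos (by
    simp only [div_ofNat_re, add_re, one_re]
    linarith)
  have hpi : (Real.sqrt Real.pi : ℂ) ≠ 0 := ofReal_ne_zero.2 (by positivity)
  exact mul_ne_zero (div_ne_zero hpi two_ne_zero) (div_ne_zero hnum hden)

end SineMoments

section GammaMoments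

open Complex Set

theorem gammaMeasure_eq_withDensity_restrict (a r : ℝ) :
    gammaMeasure a r = (volume.restrict (Ioi 0)).withDensity (gammaPDF a r) := by
  have hnull : gammaMeasure a r (Ioi 0)ᶜ = 0 := by
    rw [gammaMeasure, withDensity_apply _ measurableSet_Ioi.compl, compl_Ioi,
      setLIntegral_congr Iio_ae_eq_Iic.symm, lintegral_gammaPDF_of_nonpos le_rfl]
  rw [← restrict_withDensity measurableSet_Ioi, ← gammaMeasure]
  exact (Measure.restrict_eq_self_of_ae_mem (mem_ae_iff.2 hnull)).symm

theorem ae_pos_gammaMeasure (a r : ℝ) : ∀ᵐ x ∂gammaMeasure a r, 0 < x := by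
  rw [gammaMeasure_eq_withDensity_restrict]
  exact (withDensity_absolutelyContinuous _ _).ae_le (ae_restrict_mem measurableSet_Ioi)

theorem measurable_gammaPDF (a r : ℝ) : Measurable (gammaPDF a r) :=
  (measurable_gammaPDFReal a r).ennreal_ofReal

variable {a r : ℝ}

theorem integral_gammaMeasure {E : Type*} [NormedAddCommGroup E] [NormedSpace ℝ E] (ha : 0 < a)
    (hr : 0 < r) (f : ℝ → E) :
    ∫ x, f x ∂gammaMeasure a r = ∫ x in Ioi 0, gammaPDFReal a r x • f x := by
  rw [gammaMeasure_eq_withDensity_restrict,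
    integral_withDensity_eq_integral_toReal_smul (measurable_gammaPDF a r)
      (.of_forall fun _ => ENNReal.ofReal_lt_top)]
  simp only [gammaPDF, ENNReal.toReal_ofReal (gammaPDFReal_nonneg ha hr _)]

theorem gammaPDFReal_smul_cpow {x : ℝ} (hx : 0 < x) (s : ℂ) :
    gammaPDFReal a r x • (x : ℂ) ^ s =
      (r ^ a / Real.Gamma a : ℝ) * ((x : ℂ) ^ (a + s - 1) * exp (-(r * x))) := by
  have hx0 : (x : ℂ) ≠ 0 := ofReal_ne_zero.2 hx.ne'
  rw [gammaPDFReal, if_pos hx.le, real_smul, add_sub_right_comm, cpow_add _ _ hx0]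
  push_cast [ofReal_cpow hx.le]
  ring

theorem integral_cpow_gammaMeasure (ha : 0 < a) (hr : 0 < r) {s : ℂ} (hs : 0 < a + s.re) :
    ∫ x, (x : ℂ) ^ s ∂gammaMeasure a r = (r : ℂ) ^ (-s) * (Gamma (a + s) / Gamma a) := by
  have hr0 : (r : ℂ) ≠ 0 := ofReal_ne_zero.2 hr.ne'
  have hpow : (r : ℂ) ^ (a : ℂ) ≠ 0 := (cpow_ne_zero_iff_of_exponent_ne_zero
    (ofReal_ne_zero.2 ha.ne')).2 hr0
  rw [integral_gammaMeasure ha hr,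
    setIntegral_congr_fun measurableSet_Ioi fun x hx => gammaPDFReal_smul_cpow hx s,
    integral_const_mul, integral_cpow_mul_exp_neg_mul_Ioi (by simpa using hs) hr, one_div,
    inv_cpow_ofReal_nonneg hr.le, cpow_add _ _ hr0, cpow_neg, ofReal_div,
    ofReal_cpow hr.le, Gamma_ofReal]
  field_simp

theorem integrable_cpow_gammaMeasure (ha : 0 < a) (hr : 0 < r) {s : ℂ} (hs : 0 < a + s.re) :
    Integrable (fun x : ℝ => (x : ℂ) ^ s) (gammaMeasure a r) := by
  refine Integrable.of_integral_ne_zero ?_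
  rw [integral_cpow_gammaMeasure ha hr hs]
  have hnum : Gamma (a + s) ≠ 0 := Gamma_ne_zero_of_re_pos (by simpa using hs)
  have hden : Gamma a ≠ 0 := Gamma_ne_zero_of_re_pos (by simpa using ha)
  have hpow : (r : ℂ) ^ (-s) ≠ 0 := by
    rw [cpow_def_of_ne_zero (ofReal_ne_zero.2 hr.ne')]
    exact exp_ne_zero _
  exact mul_ne_zero hpow (div_ne_zero hnum hden)

theorem integral_norm_cpow_gammaMeasure (ha : 0 < a) (hr : 0 < r) {s : ℂ} (hs : 0 < a + s.re) :
    ∫ x : ℝ, ‖(x : ℂ) ^ s‖ ∂gammaMeasure a r =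
      ‖(r : ℂ) ^ (-s)‖ * (Real.Gamma (a + s.re) / Real.Gamma a) := by
  have hnorm : ∀ᵐ x : ℝ ∂gammaMeasure a r, ((‖(x : ℂ) ^ s‖ : ℝ) : ℂ) = (x : ℂ) ^ (s.re : ℂ) :=
    (ae_pos_gammaMeasure a r).mono fun x hx => by
      rw [norm_cpow_eq_rpow_re_of_pos hx, ofReal_cpow hx.le]
  rw [← ofReal_inj, ← integral_complex_ofReal, integral_congr_ae hnorm,
    integral_cpow_gammaMeasure ha hr (by simpa using hs), norm_cpow_eq_rpow_re_of_pos hr, neg_re]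
  push_cast [ofReal_cpow hr.le, ← Gamma_ofReal]
  rfl

end GammaMoments

section PlanarGaussian

open Set

theorem image_sq_Ioi_zero : (fun x : ℝ => x ^ 2) '' Ioi 0 = Ioi 0 :=
  Subset.antisymm (image_subset_iff.2 fun _ hx => pow_pos (mem_Ioi.1 hx) 2)
    fun y hy => ⟨Real.sqrt y, Real.sqrt_pos.2 hy, Real.sq_sqrt (le_of_lt hy)⟩

theorem injOn_sq_Ioi_zero : InjOn (fun x : ℝ => x ^ 2) (Ioi 0) := fun _ hx _ hy hxy =>
  (pow_left_inj₀ (le_of_lt hx) (le_of_lt hy) two_ne_zero).1 hxy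

theorem map_sq_add_sq_volume :
    (volume : Measure (ℝ × ℝ)).map (fun p => p.1 ^ 2 + p.2 ^ 2) =
      ENNReal.ofReal Real.pi • volume.restrict (Ioi 0) := by
  refine Measure.ext_of_lintegral _ fun f hf => ?_
  have hpolar (p : ℝ × ℝ) :
      (polarCoord.symm p).1 ^ 2 + (polarCoord.symm p).2 ^ 2 = p.1 ^ 2 := by
    simp only [polarCoord_symm_apply]
    linear_combination p.1 ^ 2 * Real.sin_sq_add_cos_sq p.2
  have hangle : volume (Ioo (-Real.pi) Real.pi) = ENNReal.ofReal Real.pi * ENNReal.ofReal 2 := by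
    rw [Real.volume_Ioo, ← ENNReal.ofReal_mul Real.pi_pos.le]
    ring_nf
  calc ∫⁻ y, f y ∂(volume : Measure (ℝ × ℝ)).map (fun p => p.1 ^ 2 + p.2 ^ 2)
      = ∫⁻ p : ℝ × ℝ, f (p.1 ^ 2 + p.2 ^ 2) := lintegral_map hf (by fun_prop)
    _ = ∫⁻ p in Ioi (0 : ℝ) ×ˢ Ioo (-Real.pi) Real.pi, ENNReal.ofReal p.1 * f (p.1 ^ 2) := by
        rw [← lintegral_comp_polarCoord_symm]
        simp only [hpolar, polarCoord_target, smul_eq_mul]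
    _ = ENNReal.ofReal Real.pi * ∫⁻ r in Ioi (0 : ℝ), ENNReal.ofReal |2 * r| * f (r ^ 2) := by
        rw [Measure.volume_eq_prod, ← Measure.prod_restrict, lintegral_prod _ (by fun_prop),
          ← lintegral_const_mul _ (by fun_prop)]
        refine setLIntegral_congr_fun measurableSet_Ioi fun r (hr : 0 < r) => ?_
        simp only [lintegral_const]
        rw [Measure.restrict_apply_univ, hangle, abs_of_pos (by positivity),
          ENNReal.ofReal_mul two_pos.le]
        ring
    _ = ENNReal.ofReal Real.pi * ∫⁻ y in Ioi (0 : ℝ), f y := by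
        conv_rhs => rw [← image_sq_Ioi_zero]
        rw [lintegral_image_eq_lintegral_abs_deriv_mul measurableSet_Ioi (f' := fun x => 2 * x)
          (fun x _ => by simpa using (hasDerivAt_pow 2 x).hasDerivWithinAt) injOn_sq_Ioi_zero]
    _ = ∫⁻ y, f y ∂(ENNReal.ofReal Real.pi • volume.restrict (Ioi 0)) := by
        rw [lintegral_smul_measure, smul_eq_mul]

theorem map_withDensity_comp {α β : Type*} [MeasurableSpace α] [MeasurableSpace β]
    (μ : Measure α) {g : α → β} {f : β → ENNReal} (hg : Measurable g) (hf : Measurable f) :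
    (μ.withDensity (f ∘ g)).map g = (μ.map g).withDensity f := by
  ext s hs
  rw [Measure.map_apply hg hs, withDensity_apply _ (hg hs), withDensity_apply _ hs,
    setLIntegral_map hs hf hg]
  rfl

theorem gaussianPDF_mul_gaussianPDF {t : ℝ} (ht : 0 < t) (x y : ℝ) :
    gaussianPDF 0 (1 / (2 * t)).toNNReal x * gaussianPDF 0 (1 / (2 * t)).toNNReal y =
      ENNReal.ofReal (t / Real.pi * Real.exp (-(t * (x ^ 2 + y ^ 2)))) := by
  rw [gaussianPDF, gaussianPDF, ← ENNReal.ofReal_mul (gaussianPDFReal_nonneg _ _ _),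
    gaussianPDFReal, gaussianPDFReal, Real.coe_toNNReal _ (by positivity), mul_mul_mul_comm,
    ← Real.exp_add, ← mul_inv, Real.mul_self_sqrt (by positivity)]
  congr 2
  · field_simp
  · congr 1
    field_simp
    ring

theorem map_sq_add_sq_gaussianReal_prod {t : ℝ} (ht : 0 < t) :
    ((gaussianReal 0 (1 / (2 * t)).toNNReal).prod (gaussianReal 0 (1 / (2 * t)).toNNReal)).map
      (fun p : ℝ × ℝ => p.1 ^ 2 + p.2 ^ 2) = expMeasure t := by
  set f : ℝ → ENNReal := fun x => ENNReal.ofReal (t / Real.pi * Real.exp (-(t * x)))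
  set g : ℝ × ℝ → ℝ := fun p => p.1 ^ 2 + p.2 ^ 2
  have hvar : (1 / (2 * t)).toNNReal ≠ 0 := (Real.toNNReal_pos.2 (by positivity)).ne'
  have hdensity : ∀ x > 0, (ENNReal.ofReal Real.pi • f) x = gammaPDF 1 t x := fun x hx => by
    rw [Pi.smul_apply, smul_eq_mul, ← ENNReal.ofReal_mul Real.pi_pos.le, gammaPDF_of_nonneg hx.le,
      Real.Gamma_one, Real.rpow_one, sub_self, Real.rpow_zero]
    congr 1
    field_simp
  calc ((gaussianReal 0 (1 / (2 * t)).toNNReal).prod (gaussianReal 0 (1 / (2 * t)).toNNReal)).map g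
      = ((volume : Measure (ℝ × ℝ)).withDensity (f ∘ g)).map g := by
        rw [gaussianReal_of_var_ne_zero 0 hvar, prod_withDensity (by fun_prop) (by fun_prop),
          ← Measure.volume_eq_prod]
        simp only [gaussianPDF_mul_gaussianPDF ht]
        rfl
    _ = (volume.map g).withDensity f := map_withDensity_comp _ (by fun_prop) (by fun_prop)
    _ = (volume.restrict (Ioi 0)).withDensity (ENNReal.ofReal Real.pi • f) := by
        rw [map_sq_add_sq_volume, withDensity_smul_measure, withDensity_smul _ (by fun_prop)]
    _ = expMeasure t := by
        rw [expMeasure, gammaMeasure_eq_withDensity_restrict]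
        exact withDensity_congr_ae ((ae_restrict_mem measurableSet_Ioi).mono hdensity)

end PlanarGaussian

namespace FoxH

section Contours

variable {m n p q : ℕ} {a : Fin p → ℂ × ℝ} {b : Fin q → ℂ × ℝ} {z : ℂ}

theorem foxH_eq_of_forall_lineIntegral_eq {L : ℂ} (hex : ∃ c, Separates m n a b c)
    (hL : ∀ c, Separates m n a b c → lineIntegral m n a b z c = L) : foxH m n a b z = L := by
  rw [foxH, dif_pos hex]
  exact hL _ hex.choose_spec

theorem lineIntegral_eq_integral (c : ℝ) :
    lineIntegral m n a b z c =
      (2 * Real.pi : ℂ)⁻¹ * ∫ t : ℝ, integrand m n a b z (c + t * Complex.I) := by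
  rw [lineIntegral, integral_mul_const]
  field_simp

end Contours

end FoxH

namespace AlphaLomax

section BitErrorRate

open Complex Set

/-- Lebesgue measure on the range `(0, π / 2)` of the angle in the integral that defines the
average bit error rate. -/
noncomputable def angleMeasure : Measure ℝ :=
  volume.restrict (Ioo 0 (Real.pi / 2))

instance : IsFiniteMeasure angleMeasure :=
  inferInstanceAs (IsFiniteMeasure (volume.restrict (Ioo 0 (Real.pi / 2))))

theorem ae_sin_pos_angleMeasure : ∀ᵐ θ ∂angleMeasure, 0 < Real.sin θ :=
  (ae_restrict_mem measurableSet_Ioo).mono fun _ => sin_pos_of_mem_Ioo_zero_pi_div_two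

variable {Ω : Type*} [MeasurableSpace Ω] {P : Measure Ω} {G : Ω → ℝ} {φ u : ℝ}

/-- The exponent `φ G / sin² θ` of the bit error rate of the signal-to-noise ratio `G`, as a
function of the outcome and of the angle `θ`. -/
noncomputable def berExponent (G : Ω → ℝ) (φ : ℝ) (p : Ω × ℝ) : ℝ :=
  φ * G p.1 / Real.sin p.2 ^ 2

/-- The Mellin transform of the average bit error rate, up to a constant factor: it is the
integrand of the Mellin–Barnes integral that represents `averageBER P G φ`. -/
noncomputable def berMellinIntegrand (P : Measure Ω) (G : Ω → ℝ) (φ : ℝ) (w : ℂ) : ℂ :=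
  Gamma w * (Gamma (w + 1 / 2) / Gamma (w + 1)) * (φ : ℂ) ^ (-w) * ∫ ω, (G ω : ℂ) ^ (-w) ∂P

theorem aemeasurable_berExponent (hG : AEMeasurable G P) :
    AEMeasurable (berExponent G φ) (P.prod angleMeasure) :=
  (hG.comp_fst.const_mul φ).div (by fun_prop)

theorem ae_pos_berExponent (hpos : ∀ᵐ ω ∂P, 0 < G ω) (hφ : 0 < φ) :
    ∀ᵐ p ∂P.prod angleMeasure, 0 < berExponent G φ p := by
  filter_upwards [Measure.quasiMeasurePreserving_fst.ae hpos,
    Measure.quasiMeasurePreserving_snd.ae ae_sin_pos_angleMeasure] with p hGp hsin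
  exact div_pos (mul_pos hφ hGp) (pow_pos hsin 2)

theorem ofReal_div_sq_cpow_neg {x y : ℝ} (hx : 0 ≤ x) (hy : 0 ≤ y) (w : ℂ) :
    ((x / y ^ 2 : ℝ) : ℂ) ^ (-w) = (x : ℂ) ^ (-w) * (y : ℂ) ^ (2 * w) := by
  have hsq : ((y ^ 2 : ℝ) : ℂ) ^ w = (y : ℂ) ^ (2 * w) := by
    rw [← Real.rpow_two, ← cpow_mul_ofReal_nonneg hy, ofReal_ofNat]
  rw [ofReal_div, div_cpow_ofReal_nonneg hx (sq_nonneg y), cpow_neg ((y ^ 2 : ℝ) : ℂ), hsq,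
    div_inv_eq_mul]

theorem berExponent_cpow_neg_ae_eq (hpos : ∀ᵐ ω ∂P, 0 < G ω) (hφ : 0 < φ) (w : ℂ) :
    (fun p => (berExponent G φ p : ℂ) ^ (-w)) =ᵐ[P.prod angleMeasure]
      fun p => (φ : ℂ) ^ (-w) * ((G p.1 : ℂ) ^ (-w) * (Real.sin p.2 : ℂ) ^ (2 * w)) := by
  filter_upwards [Measure.quasiMeasurePreserving_fst.ae hpos,
    Measure.quasiMeasurePreserving_snd.ae ae_sin_pos_angleMeasure] with p hGp hsin
  rw [berExponent, ofReal_div_sq_cpow_neg (mul_pos hφ hGp).le hsin.le, ofReal_mul,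
    mul_cpow_ofReal_nonneg hφ.le hGp.le, mul_assoc]

theorem integral_berExponent_cpow_neg [SFinite P] (hpos : ∀ᵐ ω ∂P, 0 < G ω) (hφ : 0 < φ) {w : ℂ}
    (hw : -(1 / 2) < w.re) :
    ∫ p, (berExponent G φ p : ℂ) ^ (-w) ∂P.prod angleMeasure =
      Real.sqrt Real.pi / 2 * (Gamma (w + 1 / 2) / Gamma (w + 1)) * (φ : ℂ) ^ (-w) *
        ∫ ω, (G ω : ℂ) ^ (-w) ∂P := by
  have hsin : ∫ θ, (Real.sin θ : ℂ) ^ (2 * w) ∂angleMeasure =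
      Real.sqrt Real.pi / 2 * (Gamma (w + 1 / 2) / Gamma (w + 1)) := by
    rw [angleMeasure, integral_sin_cpow (by
      simp only [mul_re, re_ofNat, im_ofNat, zero_mul, sub_zero]; linarith)]
    ring_nf
  rw [integral_congr_ae (berExponent_cpow_neg_ae_eq hpos hφ w), integral_const_mul,
    integral_prod_mul (fun ω => (G ω : ℂ) ^ (-w)) (fun θ : ℝ => (Real.sin θ : ℂ) ^ (2 * w)), hsin]
  ring

theorem integrable_berExponent_rpow_neg [SFinite P] (hG : AEMeasurable G P)
    (hpos : ∀ᵐ ω ∂P, 0 < G ω) (hφ : 0 < φ) (hu : -(1 / 2) < u)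
    (hint : Integrable (fun ω => G ω ^ (-u)) P) :
    Integrable (fun p => berExponent G φ p ^ (-u)) (P.prod angleMeasure) := by
  have hcpow : Integrable (fun ω => (G ω : ℂ) ^ (-u : ℂ)) P :=
    (integrable_ofReal_cpow_iff hG hpos _).2 hint
  have hsin : Integrable (fun θ : ℝ => (Real.sin θ : ℂ) ^ (2 * u : ℂ)) angleMeasure :=
    integrable_sin_cpow (by
      simp only [mul_re, re_ofNat, im_ofNat, zero_mul, sub_zero, ofReal_re]; linarith)
  exact (integrable_ofReal_cpow_iff (aemeasurable_berExponent hG) (ae_pos_berExponent hpos hφ)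
    (-u : ℂ)).1 (((hcpow.mul_prod hsin).const_mul _).congr
      (berExponent_cpow_neg_ae_eq hpos hφ u).symm)

theorem integrable_exp_neg_berExponent [IsFiniteMeasure P] (hG : AEMeasurable G P)
    (hpos : ∀ᵐ ω ∂P, 0 < G ω) (hφ : 0 < φ) :
    Integrable (fun p => Real.exp (-berExponent G φ p)) (P.prod angleMeasure) := by
  refine (integrable_const (1 : ℝ)).mono'
    (aemeasurable_berExponent hG).neg.exp.aestronglyMeasurable ?_
  filter_upwards [ae_pos_berExponent hpos hφ] with p hp
  rw [Real.norm_eq_abs, abs_of_pos (Real.exp_pos _), Real.exp_le_one_iff]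
  linarith

theorem laplaceMGF_div_sin_sq (P : Measure Ω) (G : Ω → ℝ) (φ θ : ℝ) :
    laplaceMGF P G (φ / Real.sin θ ^ 2) = ∫ ω, Real.exp (-berExponent G φ (ω, θ)) ∂P := by
  simp only [laplaceMGF, mgf, berExponent, neg_mul, div_mul_eq_mul_div]

theorem intervalIntegrable_laplaceMGF [IsFiniteMeasure P] (hG : AEMeasurable G P)
    (hpos : ∀ᵐ ω ∂P, 0 < G ω) (hφ : 0 < φ) :
    IntervalIntegrable (fun θ => laplaceMGF P G (φ / Real.sin θ ^ 2)) volume 0 (Real.pi / 2) := by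
  rw [intervalIntegrable_iff_integrableOn_Ioo_of_le Real.pi_div_two_pos.le]
  simpa only [laplaceMGF_div_sin_sq, IntegrableOn, angleMeasure] using
    (integrable_exp_neg_berExponent hG hpos hφ).integral_prod_right

theorem averageBER_eq_integral_prod [IsFiniteMeasure P] (hG : AEMeasurable G P)
    (hpos : ∀ᵐ ω ∂P, 0 < G ω) (hφ : 0 < φ) :
    averageBER P G φ =
      1 / Real.pi * ∫ p, Real.exp (-berExponent G φ p) ∂P.prod angleMeasure := by
  rw [averageBER, integral_prod_symm _ (integrable_exp_neg_berExponent hG hpos hφ),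
    intervalIntegral.integral_of_le Real.pi_div_two_pos.le, integral_Ioc_eq_integral_Ioo]
  simp only [laplaceMGF_div_sin_sq, angleMeasure]

theorem Gamma_mul_integral_berExponent_cpow_neg [SFinite P] (hpos : ∀ᵐ ω ∂P, 0 < G ω)
    (hφ : 0 < φ) (hu : 0 < u) (t : ℝ) :
    Gamma (u + t * I) * ∫ p, (berExponent G φ p : ℂ) ^ (-(u + t * I)) ∂P.prod angleMeasure =
      Real.sqrt Real.pi / 2 * berMellinIntegrand P G φ (u + t * I) := by
  rw [integral_berExponent_cpow_neg hpos hφ (by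
    simp only [add_re, ofReal_re, re_ofReal_mul, I_re, mul_zero, add_zero]; linarith),
    berMellinIntegrand]
  ring

theorem verticalIntegrable_berMellinIntegrand [SFinite P] (hG : AEMeasurable G P)
    (hpos : ∀ᵐ ω ∂P, 0 < G ω) (hφ : 0 < φ) (hu : 0 < u)
    (hint : Integrable (fun ω => G ω ^ (-u)) P) :
    VerticalIntegrable (berMellinIntegrand P G φ) u := by
  have hscaled := verticalIntegrable_Gamma_mul_integral_cpow hu (aemeasurable_berExponent hG)
    (ae_pos_berExponent hpos hφ)
    (integrable_berExponent_rpow_neg hG hpos hφ (by linarith) hint)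
  simp only [VerticalIntegrable, Gamma_mul_integral_berExponent_cpow_neg hpos hφ hu] at hscaled
  have hconst : (Real.sqrt Real.pi / 2 : ℂ) ≠ 0 :=
    div_ne_zero (ofReal_ne_zero.2 (by positivity)) two_ne_zero
  exact (integrable_const_mul_iff hconst.isUnit _).1 hscaled

theorem averageBER_eq_integral_berMellinIntegrand [IsFiniteMeasure P] (hG : AEMeasurable G P)
    (hpos : ∀ᵐ ω ∂P, 0 < G ω) (hφ : 0 < φ) (hu : 0 < u)
    (hint : Integrable (fun ω => G ω ^ (-u)) P) :
    (averageBER P G φ : ℂ) = Real.sqrt Real.pi / (4 * Real.pi ^ 2) *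
      ∫ t : ℝ, berMellinIntegrand P G φ (u + t * I) := by
  have hlaplace := integral_exp_neg_eq_integral_Gamma_mul hu (aemeasurable_berExponent hG)
    (ae_pos_berExponent hpos hφ)
    (integrable_berExponent_rpow_neg hG hpos hφ (by linarith) hint)
  simp only [Gamma_mul_integral_berExponent_cpow_neg hpos hφ hu, integral_const_mul] at hlaplace
  rw [averageBER_eq_integral_prod hG hpos hφ, ofReal_mul, hlaplace]
  push_cast
  ring

end BitErrorRate

section LomaxLaw

open Complex

variable {lam β : ℝ} {s : ℂ}

/-- The conditional law of the squared envelope `X² + Y²` given `τ`, as a kernel in the value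
of `τ`. -/
noncomputable def squaredEnvelopeKernel : Kernel ℝ ℝ :=
  (gaussianKernel ×ₖ gaussianKernel).map fun p => p.1 ^ 2 + p.2 ^ 2

/-- The Lomax distribution of shape `lam` and scale `β`, as the Gamma mixture of the conditional
laws of the squared envelope. -/
noncomputable def lomaxMeasure (lam β : ℝ) : Measure ℝ :=
  squaredEnvelopeKernel ∘ₘ gammaMeasure lam β

theorem squaredEnvelopeKernel_apply {t : ℝ} (ht : 0 < t) :
    squaredEnvelopeKernel t = expMeasure t := by
  rw [squaredEnvelopeKernel, Kernel.map_apply _ (by fun_prop), Kernel.prod_apply]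
  exact map_sq_add_sq_gaussianReal_prod ht

theorem ae_squaredEnvelopeKernel_eq (lam β : ℝ) :
    ∀ᵐ t ∂gammaMeasure lam β, squaredEnvelopeKernel t = expMeasure t :=
  (ae_pos_gammaMeasure lam β).mono fun _ => squaredEnvelopeKernel_apply

theorem ae_pos_lomaxMeasure (lam β : ℝ) : ∀ᵐ x ∂lomaxMeasure lam β, 0 < x := by
  refine Measure.ae_comp_of_ae_ae measurableSet_Ioi ?_
  filter_upwards [ae_squaredEnvelopeKernel_eq lam β] with t ht
  rw [ht]
  exact ae_pos_gammaMeasure 1 t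

theorem integrable_cpow_lomaxMeasure (hlam : 0 < lam) (hβ : 0 < β) (hs : -1 < s.re)
    (hs' : s.re < lam) : Integrable (fun x : ℝ => (x : ℂ) ^ s) (lomaxMeasure lam β) := by
  have hs1 : 0 < 1 + s.re := by linarith
  rw [lomaxMeasure, Measure.integrable_comp_iff (Measurable.aestronglyMeasurable (by fun_prop))]
  constructor
  · filter_upwards [ae_pos_gammaMeasure lam β] with t ht
    rw [squaredEnvelopeKernel_apply ht]
    exact integrable_cpow_gammaMeasure one_pos ht hs1
  · have hmoment : Integrable (fun t : ℝ => (t : ℂ) ^ (-s)) (gammaMeasure lam β) :=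
      integrable_cpow_gammaMeasure hlam hβ (by rw [neg_re]; linarith)
    refine (hmoment.norm.mul_const (Real.Gamma (1 + s.re) / Real.Gamma 1)).congr ?_
    filter_upwards [ae_pos_gammaMeasure lam β] with t ht
    rw [squaredEnvelopeKernel_apply ht]
    exact (integral_norm_cpow_gammaMeasure one_pos ht hs1).symm

theorem integral_cpow_lomaxMeasure (hlam : 0 < lam) (hβ : 0 < β) (hs : -1 < s.re)
    (hs' : s.re < lam) :
    ∫ x, (x : ℂ) ^ s ∂lomaxMeasure lam β =
      (β : ℂ) ^ s * (Gamma (1 + s) * Gamma (lam - s) / Gamma lam) := by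
  have hinner : ∀ᵐ t ∂gammaMeasure lam β,
      ∫ x, (x : ℂ) ^ s ∂squaredEnvelopeKernel t = (t : ℂ) ^ (-s) * Gamma (1 + s) := by
    filter_upwards [ae_pos_gammaMeasure lam β] with t ht
    rw [squaredEnvelopeKernel_apply ht, expMeasure,
      integral_cpow_gammaMeasure one_pos ht (by linarith), ofReal_one, Gamma_one, div_one]
  have hint := integrable_cpow_lomaxMeasure hlam hβ hs hs'
  rw [lomaxMeasure, Measure.comp_eq_comp_const_apply] at hint ⊢
  rw [Kernel.integral_comp hint, Kernel.const_apply, integral_congr_ae hinner, integral_mul_const,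
    integral_cpow_gammaMeasure hlam hβ (by rw [neg_re]; linarith), neg_neg, ← sub_eq_add_neg]
  ring

variable {Ω : Type*} [MeasurableSpace Ω] {P : Measure Ω} {τ X Y : Ω → ℝ}

namespace IsLomaxModel

theorem aemeasurable_sq_add_sq (h : IsLomaxModel P lam β τ X Y) :
    AEMeasurable (fun ω => X ω ^ 2 + Y ω ^ 2) P :=
  (h.aemeasurable_X.pow_const 2).add (h.aemeasurable_Y.pow_const 2)

theorem map_sq_add_sq (h : IsLomaxModel P lam β τ X Y) (hlam : 0 < lam) (hβ : 0 < β) :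
    P.map (fun ω => X ω ^ 2 + Y ω ^ 2) = lomaxMeasure lam β := by
  have := isProbabilityMeasure_gammaMeasure hlam hβ
  have hradius : Measurable fun p : ℝ × ℝ => p.1 ^ 2 + p.2 ^ 2 := by fun_prop
  have htriple : AEMeasurable (fun ω => (τ ω, X ω, Y ω)) P :=
    h.aemeasurable_tau.prodMk (h.aemeasurable_X.prodMk h.aemeasurable_Y)
  calc P.map (fun ω => X ω ^ 2 + Y ω ^ 2)
      = ((P.map fun ω => (τ ω, X ω, Y ω)).snd).map fun p => p.1 ^ 2 + p.2 ^ 2 := by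
        rw [Measure.snd, Measure.map_map hradius measurable_snd,
          AEMeasurable.map_map_of_aemeasurable (hradius.comp measurable_snd).aemeasurable htriple]
        rfl
    _ = lomaxMeasure lam β := by
        rw [h.law, Measure.snd_compProd, Measure.map_comp _ _ hradius]
        rfl

theorem ae_pos_sq_add_sq (h : IsLomaxModel P lam β τ X Y) (hlam : 0 < lam) (hβ : 0 < β) :
    ∀ᵐ ω ∂P, 0 < X ω ^ 2 + Y ω ^ 2 :=
  ae_of_ae_map h.aemeasurable_sq_add_sq (by
    rw [h.map_sq_add_sq hlam hβ]
    exact ae_pos_lomaxMeasure lam β)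

theorem integrable_sq_add_sq_cpow (h : IsLomaxModel P lam β τ X Y) (hlam : 0 < lam) (hβ : 0 < β)
    (hs : -1 < s.re) (hs' : s.re < lam) :
    Integrable (fun ω => ((X ω ^ 2 + Y ω ^ 2 : ℝ) : ℂ) ^ s) P := by
  have hint := integrable_cpow_lomaxMeasure hlam hβ hs hs'
  rw [← h.map_sq_add_sq hlam hβ] at hint
  exact hint.comp_aemeasurable h.aemeasurable_sq_add_sq

theorem integral_sq_add_sq_cpow (h : IsLomaxModel P lam β τ X Y) (hlam : 0 < lam) (hβ : 0 < β)
    (hs : -1 < s.re) (hs' : s.re < lam) :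
    ∫ ω, ((X ω ^ 2 + Y ω ^ 2 : ℝ) : ℂ) ^ s ∂P =
      (β : ℂ) ^ s * (Gamma (1 + s) * Gamma (lam - s) / Gamma lam) := by
  rw [← integral_cpow_lomaxMeasure hlam hβ hs hs', ← h.map_sq_add_sq hlam hβ,
    integral_map h.aemeasurable_sq_add_sq (Measurable.aestronglyMeasurable (by fun_prop))]

end IsLomaxModel

end LomaxLaw

section SignalToNoiseRatio

open Complex

variable {α lam β γbar : ℝ} {s : ℂ}

theorem Gamma_ratio_pos (hα : 0 < α) (hlam : 1 / α < lam) :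
    0 < Real.Gamma (1 + 1 / α) * Real.Gamma (lam - 1 / α) / Real.Gamma lam := by
  have hα' : 0 < 1 / α := one_div_pos.2 hα
  exact div_pos (mul_pos (Real.Gamma_pos_of_pos (by linarith))
    (Real.Gamma_pos_of_pos (by linarith))) (Real.Gamma_pos_of_pos (by linarith))

theorem zeta_pos (hα : 0 < α) (hlam : 1 / α < lam) : 0 < zeta α lam :=
  Real.rpow_pos_of_pos (Gamma_ratio_pos hα hlam) α

theorem zeta_rpow_one_div (hα : 0 < α) (hlam : 1 / α < lam) :
    zeta α lam ^ (1 / α) =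
      Real.Gamma (1 + 1 / α) * Real.Gamma (lam - 1 / α) / Real.Gamma lam := by
  rw [zeta, ← Real.rpow_mul (Gamma_ratio_pos hα hlam).le, mul_one_div_cancel hα.ne',
    Real.rpow_one]

variable {Ω : Type*} [MeasurableSpace Ω] {P : Measure Ω} {τ X Y : Ω → ℝ}

namespace IsLomaxModel

theorem integral_fading (h : IsLomaxModel P lam β τ X Y) (hα : 0 < α) (hlam : 1 / α < lam)
    (hβ : 0 < β) : ∫ ω, fading α X Y ω ∂P = (β * zeta α lam) ^ (1 / α) := by
  have hα' : 0 < 1 / α := one_div_pos.2 hα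
  have hfading (ω : Ω) : (fading α X Y ω : ℂ) =
      ((X ω ^ 2 + Y ω ^ 2 : ℝ) : ℂ) ^ ((1 / α : ℝ) : ℂ) :=
    ofReal_cpow (by positivity) _
  rw [Real.mul_rpow hβ.le (zeta_pos hα hlam).le, zeta_rpow_one_div hα hlam, ← ofReal_inj,
    ← integral_complex_ofReal]
  simp only [hfading]
  rw [h.integral_sq_add_sq_cpow (hα'.trans hlam) hβ (by rw [ofReal_re]; linarith)
    (by rwa [ofReal_re]), ← ofReal_cpow hβ.le]
  push_cast [← Gamma_ofReal]
  rfl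

theorem snr_eq (h : IsLomaxModel P lam β τ X Y) (hα : 0 < α) (hlam : 1 / α < lam) (hβ : 0 < β)
    (hγ : 0 < γbar) (ω : Ω) :
    snr P α γbar X Y ω =
      (γbar ^ α / (β * zeta α lam) * (X ω ^ 2 + Y ω ^ 2)) ^ (1 / α) := by
  have hζ := zeta_pos hα hlam
  have hscale : (γbar ^ α / (β * zeta α lam)) ^ (1 / α) = γbar / (β * zeta α lam) ^ (1 / α) := by
    rw [Real.div_rpow (by positivity) (by positivity), ← Real.rpow_mul hγ.le,
      mul_one_div_cancel hα.ne', Real.rpow_one]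
  rw [Real.mul_rpow (by positivity) (by positivity), hscale, snr, power, fading,
    h.integral_fading hα hlam hβ]
  ring

theorem aemeasurable_snr (h : IsLomaxModel P lam β τ X Y) (α γbar : ℝ) :
    AEMeasurable (snr P α γbar X Y) P :=
  ((h.aemeasurable_sq_add_sq.pow_const (1 / α)).div_const _).const_mul γbar

theorem ae_pos_snr (h : IsLomaxModel P lam β τ X Y) (hα : 0 < α) (hlam : 1 / α < lam)
    (hβ : 0 < β) (hγ : 0 < γbar) : ∀ᵐ ω ∂P, 0 < snr P α γbar X Y ω := by
  have hζ := zeta_pos hα hlam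
  filter_upwards [h.ae_pos_sq_add_sq ((one_div_pos.2 hα).trans hlam) hβ] with ω hω
  rw [h.snr_eq hα hlam hβ hγ]
  positivity

theorem snr_cpow (h : IsLomaxModel P lam β τ X Y) (hα : 0 < α) (hlam : 1 / α < lam) (hβ : 0 < β)
    (hγ : 0 < γbar) (s : ℂ) (ω : Ω) :
    (snr P α γbar X Y ω : ℂ) ^ (α * s) =
      ((γbar ^ α / (β * zeta α lam) : ℝ) : ℂ) ^ s * ((X ω ^ 2 + Y ω ^ 2 : ℝ) : ℂ) ^ s := by
  have hζ := zeta_pos hα hlam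
  have hexp : ((1 / α : ℝ) : ℂ) * (α * s) = s := by
    rw [← mul_assoc, ← ofReal_mul, one_div_mul_cancel hα.ne', ofReal_one, one_mul]
  rw [h.snr_eq hα hlam hβ hγ, ← cpow_mul_ofReal_nonneg (by positivity), hexp, ofReal_mul,
    mul_cpow_ofReal_nonneg (by positivity) (by positivity)]

theorem integrable_snr_rpow (h : IsLomaxModel P lam β τ X Y) (hα : 0 < α) (hlam : 1 / α < lam)
    (hβ : 0 < β) (hγ : 0 < γbar) {c : ℝ} (hc : -1 < c) (hc' : c < lam) :
    Integrable (fun ω => snr P α γbar X Y ω ^ (α * c)) P := by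
  have hcpow : Integrable (fun ω => (snr P α γbar X Y ω : ℂ) ^ (α * c : ℂ)) P := by
    simp only [h.snr_cpow hα hlam hβ hγ]
    exact (h.integrable_sq_add_sq_cpow ((one_div_pos.2 hα).trans hlam) hβ
      (by rwa [ofReal_re]) (by rwa [ofReal_re])).const_mul _
  simpa only [re_ofReal_mul, ofReal_re] using (integrable_ofReal_cpow_iff
    (h.aemeasurable_snr α γbar) (h.ae_pos_snr hα hlam hβ hγ) _).1 hcpow

theorem integral_snr_cpow (h : IsLomaxModel P lam β τ X Y) (hα : 0 < α) (hlam : 1 / α < lam)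
    (hβ : 0 < β) (hγ : 0 < γbar) (hs : -1 < s.re) (hs' : s.re < lam) :
    ∫ ω, (snr P α γbar X Y ω : ℂ) ^ (α * s) ∂P =
      ((γbar ^ α / zeta α lam : ℝ) : ℂ) ^ s * (Gamma (1 + s) * Gamma (lam - s) / Gamma lam) := by
  have hζ := zeta_pos hα hlam
  have hconst : γbar ^ α / zeta α lam = γbar ^ α / (β * zeta α lam) * β := by field_simp
  simp only [h.snr_cpow hα hlam hβ hγ]
  rw [integral_const_mul, h.integral_sq_add_sq_cpow ((one_div_pos.2 hα).trans hlam) hβ hs hs',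
    hconst, ofReal_mul, mul_cpow_ofReal_nonneg (by positivity) hβ.le]
  ring

end IsLomaxModel

end SignalToNoiseRatio

section MellinBarnes

open Complex

variable {α lam β γbar φ c : ℝ} {s : ℂ}

theorem re_lt_of_pole_lower (hc : -1 < c) {j : Fin 2} (hj : (j : ℕ) < 1) {k : ℕ}
    (hpole : (lower α j).1 + (lower α j).2 * s = -(k : ℂ)) : s.re < c := by
  obtain rfl : j = 0 := by omega
  have hre : 1 + s.re = -k := by simpa [lower] using congrArg re hpole
  linarith [k.cast_nonneg (α := ℝ)]

theorem re_nonneg_of_pole_upper (hα : 0 < α) (hlam : 0 < lam) (j : Fin 4) {k : ℕ}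
    (hpole : 1 - (upper α lam j).1 - (upper α lam j).2 * s = -(k : ℂ)) : 0 ≤ s.re := by
  have hk : (0 : ℝ) ≤ k := k.cast_nonneg
  have hre : 1 - (upper α lam j).1.re - (upper α lam j).2 * s.re = -k := by
    simpa using congrArg re hpole
  fin_cases j
  · have hpole' : 1 - 1 / 2 - α * s.re = -k := by simpa [upper] using hre
    exact nonneg_of_mul_nonneg_right (by linarith) hα
  · have hpole' : (1 : ℝ) - 1 / 2 = -k := by simpa [upper] using hre
    linarith
  · have hpole' : lam - s.re = -k := by simpa [upper] using hre
    linarith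
  · have hpole' : α * s.re = k := by simpa [upper] using hre
    exact nonneg_of_mul_nonneg_right (hpole' ▸ hk) hα

theorem separates_upper_lower_iff (hα : 0 < α) (hlam : 0 < lam) :
    FoxH.Separates 1 4 (upper α lam) (lower α) c ↔ -1 < c ∧ c < 0 := by
  refine ⟨fun ⟨hlower, hupper⟩ => ⟨?_, ?_⟩, fun ⟨hc, hc'⟩ =>
    ⟨fun j hj s k => re_lt_of_pole_lower hc hj,
      fun j _ s k hpole => hc'.trans_le (re_nonneg_of_pole_upper hα hlam j hpole)⟩⟩
  · simpa using hlower 0 (by simp) (-1) 0 (by simp [lower])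
  · simpa using hupper 3 (by simp) 0 0 (by simp [upper])

theorem integrand_upper_lower (α lam : ℝ) (z s : ℂ) :
    FoxH.integrand 1 4 (upper α lam) (lower α) z s =
      Gamma (1 + s) * (Gamma (1 - α * s))⁻¹ *
        (Gamma (1 / 2 - α * s) * Real.sqrt Real.pi * Gamma (lam - s) * Gamma (-(α * s))) *
          z ^ (-s) := by
  have hhalf : (1 : ℂ) - 2⁻¹ = 2⁻¹ := by norm_num
  have hsqrt : Gamma 2⁻¹ = Real.sqrt Real.pi := by
    rw [← Real.Gamma_one_half_eq, ← Gamma_ofReal, ofReal_div, ofReal_one, ofReal_ofNat, one_div]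
  rw [FoxH.integrand, Fin.prod_univ_two, Fin.prod_univ_four]
  simp [upper, lower, hhalf, hsqrt]

theorem ofReal_div_mul_rpow_cpow_neg {ζ : ℝ} (hζ : 0 < ζ) (hγ : 0 < γbar) (hφ : 0 < φ) (s : ℂ) :
    ((ζ / (γbar ^ α * φ ^ α) : ℝ) : ℂ) ^ (-s) =
      ((γbar ^ α / ζ : ℝ) : ℂ) ^ s * (φ : ℂ) ^ (α * s) := by
  have hinv : ζ / (γbar ^ α * φ ^ α) = (γbar ^ α / ζ * φ ^ α) ^ (-1 : ℝ) := by
    rw [Real.rpow_neg_one]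
    field_simp
  rw [hinv, ← cpow_mul_ofReal_nonneg (by positivity), ofReal_neg, ofReal_one, neg_one_mul, neg_neg,
    ofReal_mul, mul_cpow_ofReal_nonneg (by positivity) (by positivity),
    ← cpow_mul_ofReal_nonneg hφ.le]

variable {Ω : Type*} [MeasurableSpace Ω] {P : Measure Ω} {τ X Y : Ω → ℝ}

namespace IsLomaxModel

theorem integrand_eq_berMellinIntegrand (h : IsLomaxModel P lam β τ X Y) (hα : 0 < α)
    (hlam : 1 / α < lam) (hβ : 0 < β) (hγ : 0 < γbar) (hφ : 0 < φ) (hs : -1 < s.re)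
    (hs' : s.re < lam) :
    FoxH.integrand 1 4 (upper α lam) (lower α)
        ((zeta α lam / (γbar ^ α * φ ^ α) : ℝ) : ℂ) s =
      Real.sqrt Real.pi * Gamma lam *
        berMellinIntegrand P (snr P α γbar X Y) φ ((-α : ℝ) * s) := by
  have hΓ : Gamma lam ≠ 0 :=
    Gamma_ne_zero_of_re_pos (by rw [ofReal_re]; exact (one_div_pos.2 hα).trans hlam)
  rw [integrand_upper_lower, ofReal_div_mul_rpow_cpow_neg (zeta_pos hα hlam) hγ hφ,
    berMellinIntegrand, ofReal_neg, neg_mul, neg_neg, h.integral_snr_cpow hα hlam hβ hγ hs hs',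
    neg_add_eq_sub, neg_add_eq_sub]
  field_simp

theorem integrand_verticalLine_eq (h : IsLomaxModel P lam β τ X Y) (hα : 0 < α)
    (hlam : 1 / α < lam) (hβ : 0 < β) (hγ : 0 < γbar) (hφ : 0 < φ) (hc : -1 < c) (hc' : c < lam)
    (t : ℝ) :
    FoxH.integrand 1 4 (upper α lam) (lower α)
        ((zeta α lam / (γbar ^ α * φ ^ α) : ℝ) : ℂ) (c + t * I) =
      Real.sqrt Real.pi * Gamma lam *
        berMellinIntegrand P (snr P α γbar X Y) φ ((-α : ℝ) * (c + t * I)) :=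
  h.integrand_eq_berMellinIntegrand hα hlam hβ hγ hφ
    (by simpa only [add_re, ofReal_re, re_ofReal_mul, I_re, mul_zero, add_zero])
    (by simpa only [add_re, ofReal_re, re_ofReal_mul, I_re, mul_zero, add_zero])

theorem verticalIntegrable_integrand [SFinite P] (h : IsLomaxModel P lam β τ X Y) (hα : 0 < α)
    (hlam : 1 / α < lam) (hβ : 0 < β) (hγ : 0 < γbar) (hφ : 0 < φ) (hc : -1 < c) (hc' : c < 0) :
    VerticalIntegrable (FoxH.integrand 1 4 (upper α lam) (lower α)
      ((zeta α lam / (γbar ^ α * φ ^ α) : ℝ) : ℂ)) c := by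
  have hclam : c < lam := hc'.trans ((one_div_pos.2 hα).trans hlam)
  have hber : VerticalIntegrable (berMellinIntegrand P (snr P α γbar X Y) φ) (-α * c) :=
    verticalIntegrable_berMellinIntegrand (h.aemeasurable_snr α γbar)
      (h.ae_pos_snr hα hlam hβ hγ) hφ (mul_pos_of_neg_of_neg (neg_neg_of_pos hα) hc')
      (by simpa only [neg_mul, neg_neg] using h.integrable_snr_rpow hα hlam hβ hγ hc hclam)
  refine ((verticalIntegrable_comp_mul_left (neg_ne_zero.2 hα.ne') hber).const_mul
    (Real.sqrt Real.pi * Gamma lam)).congr (.of_forall fun t => ?_)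
  exact (h.integrand_verticalLine_eq hα hlam hβ hγ hφ hc hclam t).symm

theorem lineIntegral_eq_averageBER [IsFiniteMeasure P] (h : IsLomaxModel P lam β τ X Y)
    (hα : 0 < α) (hlam : 1 / α < lam) (hβ : 0 < β) (hγ : 0 < γbar) (hφ : 0 < φ) (hc : -1 < c)
    (hc' : c < 0) :
    FoxH.lineIntegral 1 4 (upper α lam) (lower α)
        ((zeta α lam / (γbar ^ α * φ ^ α) : ℝ) : ℂ) c =
      2 * Real.pi * Gamma lam / α * averageBER P (snr P α γbar X Y) φ := by
  have hclam : c < lam := hc'.trans ((one_div_pos.2 hα).trans hlam)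
  have hα' : (α : ℂ) ≠ 0 := ofReal_ne_zero.2 hα.ne'
  have hpi : (Real.pi : ℂ) ≠ 0 := ofReal_ne_zero.2 Real.pi_ne_zero
  rw [averageBER_eq_integral_berMellinIntegrand (h.aemeasurable_snr α γbar)
    (h.ae_pos_snr hα hlam hβ hγ) hφ (mul_pos_of_neg_of_neg (neg_neg_of_pos hα) hc')
    (by simpa only [neg_mul, neg_neg] using h.integrable_snr_rpow hα hlam hβ hγ hc hclam)]
  simp only [FoxH.lineIntegral_eq_integral,
    h.integrand_verticalLine_eq hα hlam hβ hγ hφ hc hclam, integral_const_mul,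
    integral_verticalLine_comp_mul_left, inv_neg, abs_neg, abs_of_pos (inv_pos.2 hα), real_smul]
  generalize ∫ t : ℝ, berMellinIntegrand P (snr P α γbar X Y) φ ((-α * c : ℝ) + t * I) = J
  push_cast
  field_simp
  ring

end IsLomaxModel

end MellinBarnes

end AlphaLomax

theorem mainTheorem5 {Ω : Type*} [MeasurableSpace Ω] (P : MeasureTheory.Measure Ω)
    [MeasureTheory.IsProbabilityMeasure P] (α lam β γbar φ : ℝ)
    (hα : 0 < α) (hlam : 1 / α < lam) (hβ : 0 < β) (hγbar : 0 < γbar) (hφ : 0 < φ)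
    (τ X Y : Ω → ℝ) (hmodel : AlphaLomax.IsLomaxModel P lam β τ X Y) :
    -- the integral that defines the average BER converges
    IntervalIntegrable
      (fun θ : ℝ =>
        AlphaLomax.laplaceMGF P (AlphaLomax.snr P α γbar X Y) (φ / Real.sin θ ^ 2))
      MeasureTheory.volume 0 (Real.pi / 2) ∧
    -- the Fox H-function is well defined: there is a separating line, and along every such line
    -- the Mellin–Barnes integral converges absolutely and has the same value
    (∃ c : ℝ, FoxH.Separates 1 4 (AlphaLomax.upper α lam) (AlphaLomax.lower α) c) ∧
    (∀ c : ℝ, FoxH.Separates 1 4 (AlphaLomax.upper α lam) (AlphaLomax.lower α) c →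
      MeasureTheory.Integrable (fun t : ℝ =>
        FoxH.integrand 1 4 (AlphaLomax.upper α lam) (AlphaLomax.lower α)
          ((AlphaLomax.zeta α lam / (γbar ^ α * φ ^ α) : ℝ) : ℂ) (c + t * Complex.I)) ∧
      FoxH.lineIntegral 1 4 (AlphaLomax.upper α lam) (AlphaLomax.lower α)
          ((AlphaLomax.zeta α lam / (γbar ^ α * φ ^ α) : ℝ) : ℂ) c =
        foxH 1 4 (AlphaLomax.upper α lam) (AlphaLomax.lower α)
          ((AlphaLomax.zeta α lam / (γbar ^ α * φ ^ α) : ℝ) : ℂ)) ∧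
    -- the closed form
    ((AlphaLomax.averageBER P (AlphaLomax.snr P α γbar X Y) φ : ℝ) : ℂ) =
      ((α / (2 * Real.pi * Real.Gamma lam) : ℝ) : ℂ) *
        foxH 1 4 (AlphaLomax.upper α lam) (AlphaLomax.lower α)
          ((AlphaLomax.zeta α lam / (γbar ^ α * φ ^ α) : ℝ) : ℂ) := by
  have hsep {c : ℝ} := AlphaLomax.separates_upper_lower_iff (c := c) hα
    ((one_div_pos.2 hα).trans hlam)
  have hex : ∃ c : ℝ, FoxH.Separates 1 4 (AlphaLomax.upper α lam) (AlphaLomax.lower α) c :=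
    ⟨-1 / 2, hsep.2 ⟨by norm_num, by norm_num⟩⟩
  have hline (c : ℝ) (hc : FoxH.Separates 1 4 (AlphaLomax.upper α lam) (AlphaLomax.lower α) c) :=
    hmodel.lineIntegral_eq_averageBER hα hlam hβ hγbar hφ (hsep.1 hc).1 (hsep.1 hc).2
  have hfox := FoxH.foxH_eq_of_forall_lineIntegral_eq hex hline
  refine ⟨AlphaLomax.intervalIntegrable_laplaceMGF (hmodel.aemeasurable_snr α γbar)
    (hmodel.ae_pos_snr hα hlam hβ hγbar) hφ, hex, fun c hc =>
      ⟨hmodel.verticalIntegrable_integrand hα hlam hβ hγbar hφ (hsep.1 hc).1 (hsep.1 hc).2,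
        (hline c hc).trans hfox.symm⟩, ?_⟩
  have hΓ : Real.Gamma lam ≠ 0 :=
    (Real.Gamma_pos_of_pos ((one_div_pos.2 hα).trans hlam)).ne'
  rw [hfox, Complex.Gamma_ofReal]
  norm_cast
  field_simp
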